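/- Let $\mathcal S,\mathcal A$ be finite nonempty sets, $S=|\mathcal S|$, $A=|\mathcal A|$, and let $\mathcal P(\cdot)$ denote probability vectors. Consider a mean-field game with transition kernel $P(\cdot\mid s,a,\mu)\in\mathcal P(\mathcal S)$ and reward $R(s,a,\mu)\in[0,1]$ ($s\in\mathcal S$, $a\in\mathcal A$, $\mu\in\mathcal P(\mathcal S)$) and discount factor $\rho\in(0,1)$. For a policy $\pi:\mathcal S\to\mathcal P(\mathcal A)$ put $P_{\pi,\mu}(s,s')=\sum_a P(s'\mid s,a,\mu)\,\pi(a\mid s)$, and $\|\pi-\pi'\|_{TV}=\max_s\sum_a|\pi(a\mid s)-\pi'(a\mid s)|$. Let $\mathcal N\subset\mathcal P(\mathcal S)$ be a finite $\epsilon^{\rm net}$-net in $\|\cdot\|_1$, and let $\mathrm{proj}$ map each $\mu$ to an $\ell^1$-nearest point of $\mathcal N$. *Algorithm.* Let $0<c_\mu\le1$, $0<c_\pi\le1$, $0<\psi<1$, $0<\theta<\gamma<1<\zeta$, $\lambda>0$, $c_\beta>0$, $\frac12<\nu\le1$, and $c^k_{\mu,t}=c_\mu k^{-\gamma}t^{-\zeta}$,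 $c^k_{\pi,t}=c_\pi k^{-\theta}t^{-\zeta}$, $\beta_t=c_\beta/(t+1)^\nu$. Start from $s^1_1\sim p_1$, a mean-field $\mu^1_0$, a policy $\pi^1_0$, a row-stochastic matrix $\hat P^1_1$ and a function $Q^1_1$. In episodes $k=1,2,\dots$ and timesteps $t=1,\dots,T$: 1. $\mu^k_t=(1-c^k_{\mu,t})\mu^k_{t-1}+c^k_{\mu,t}(\hat P^k_t)^\top\mu^k_{t-1}$, followed by $\mathrm{proj}$ if $t=1$, and $\pi^k_t=(1-c^k_{\pi,t})\pi^k_{t-1}+c^k_{\pi,t}\big((1-\psi)\,\mathrm{softmax}_\lambda(\cdot,Q^k_t)+\psi\,\mathrm{unif}_{\mathcal A}\big)$, where $\mathrm{softmax}_\lambda(s,Q)_a=e^{\lambda Q(s,a)}/\sum_{a'}e^{\lambda Q(s,a')}$; 2. draw $a^k_t\sim\pi^k_t(\cdot\mid s^k_t)$ and then $s^k_{t+1}\sim P(\cdot\mid s^k_t,a^k_t,\mu^k_t)$; 3. $\hat P^k_{t+1}(i,j)=\dfrac{N^k_t(i,j)+1/S}{N^k_t(i)+1}$, where $N^k_t(i,j)=|\{l\le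 t: s^k_l=i,\ s^k_{l+1}=j\}|$ and $N^k_t(i)=\sum_jN^k_t(i,j)$; 4. $Q^k_{t+1}(s^k_t,a^k_t)=(1-\beta_t)Q^k_t(s^k_t,a^k_t)+\beta_t\big(R(s^k_t,a^k_t,\mu^k_t)+\rho\max_{a}Q^k_t(s^k_{t+1},a)\big)$, the other entries of $Q^k_t$ being unchanged. Episode $k+1$ starts from $\hat P^{k+1}_1=\hat P^k_{T+1}$, $Q^{k+1}_1=Q^k_{T+1}$, $\mu^{k+1}_0=\mu^k_T$, $\pi^{k+1}_0=\pi^k_T$, $s^{k+1}_1=s^k_{T+1}$. *Statement.* Assume - (communicating MDP) for every $\tilde\mu\in\mathcal N$ there is a finite horizon $H(\tilde\mu)$ such that for all states $s,s'$ and all $t\ge H(\tilde\mu)$ there are actions $\tilde a_1,\dots,\tilde a_t$ with $\mathbb P(s_t=s'\mid a_1=\tilde a_1,\dots,a_t=\tilde a_t,\ s_1=s,\ \mu=\tilde\mu)>0$; - (Lipschitz) there are constants $L^\pi_P,L^\mu_P$ such that $\|P_{\pi,\mu}-P_{\pi',\mu}\|_F\le L^\pi_P\|\pi-\pi'\|_{TV}$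 and $\|P_{\pi,\mu}-P_{\pi,\mu'}\|_F\le L^\mu_P\|\mu-\mu'\|_1$ for all policies $\pi,\pi'$ and all $\mu,\mu'\in\mathcal P(\mathcal S)$. Then there are constants $C\in\mathbb R$ and $p\in\mathbb N$, depending only on the game, the net and its projection, $L^\pi_P,L^\mu_P,c_\mu,c_\pi$ and $\psi$ (in particular not on $T,k,\zeta,\delta_P$), such that for all $T\ge1$, $k\ge1$, $\delta_P\in(0,1)$, all $\theta,\gamma,\zeta,\lambda,c_\beta,\nu$ as above and every initialization, $$\epsilon^k_P:=\|\hat P^k_T-P_{\pi^k_1,\mu^k_1}\|_F\le C\big(\ell^{\,p}\,T^{-1/2}+\ell^{\,p}\,T^{-1}+2^{1-\zeta}\big),\qquad \ell=1+\log T+\log(1/\delta_P),$$ with probability at least $1-\delta_P$; that is, $\epsilon^k_P=\tilde{\mathcal O}(T^{-1/2})+\tilde{\mathcal O}(T^{-1})+\mathcal O(2^{1-\zeta})$. -/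

import Mathlib

attribute [local instance] Matrix.frobeniusNormedAddCommGroup

/-- Probability vectors on a finite set, `𝒫(X)`. -/
abbrev Simplex (X : Type*) [Fintype X] : Type _ := stdSimplex ℝ X

namespace Sandbox

noncomputable section

/-! ### Probability vectors -/

section Vectors

variable {X Y : Type*} [Fintype X] [Fintype Y]

/-- The convex combination `(1 - c) p + c q`, for `0 ≤ c ≤ 1`. -/
def mix (c : unitInterval) (p q : Simplex X) : Simplex X :=
  ⟨fun x => (1 - (c : ℝ)) * p x + (c : ℝ) * q x, by
    refine ⟨fun x => ?_, ?_⟩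
    · have h1 := p.2.1 x
      have h2 := q.2.1 x
      exact add_nonneg (mul_nonneg (sub_nonneg.2 c.2.2) h1) (mul_nonneg c.2.1 h2)
    · rw [Finset.sum_add_distrib, ← Finset.mul_sum, ← Finset.mul_sum]
      have h1 : ∑ x, p x = 1 := p.2.2
      have h2 : ∑ x, q x = 1 := q.2.2
      rw [h1, h2]
      ring⟩

/-- The vector `Mᵀ p` for a row-stochastic matrix `M` (row `x` is the probability vector `M x`). -/
def push (M : X → Simplex Y) (p : Simplex X) : Simplex Y :=
  ⟨fun y => ∑ x, M x y * p x, by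
    refine ⟨fun y => Finset.sum_nonneg fun x _ => mul_nonneg ((M x).2.1 y) (p.2.1 x), ?_⟩
    rw [Finset.sum_comm]
    have h : ∀ x, ∑ y, M x y * p x = p x := fun x => by
      rw [← Finset.sum_mul]
      have h1 : ∑ y, M x y = 1 := (M x).2.2
      rw [h1, one_mul]
    simp only [h]
    exact p.2.2⟩

/-- The Boltzmann distribution `exp (lam * q x) / ∑ x', exp (lam * q x')`. -/
def softmax [Nonempty X] (lam : ℝ) (q : X → ℝ) : Simplex X :=
  ⟨fun x => Real.exp (lam * q x) / ∑ x', Real.exp (lam * q x'), by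
    refine ⟨fun x => by positivity, ?_⟩
    rw [← Finset.sum_div]
    exact div_self (Finset.sum_pos (fun _ _ => Real.exp_pos _) Finset.univ_nonempty).ne'⟩

/-- The smoothed empirical transition matrix: `(N (i,j) + 1/S) / (N i + 1)`,
where `N i = ∑ j, N (i,j)` and `S` is the number of states. -/
def smoothed [Nonempty X] (N : X → X → ℕ) (i : X) : Simplex X :=
  ⟨fun j => ((N i j : ℝ) + 1 / (Fintype.card X : ℝ)) / ((∑ j', (N i j' : ℝ)) + 1), by
    refine ⟨fun j => by positivity, ?_⟩
    have h : (Fintype.card X : ℝ) ≠ 0 := Nat.cast_ne_zero.2 Fintype.card_ne_zero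
    have h2 : (∑ j', (N i j' : ℝ)) + 1 ≠ 0 := by positivity
    rw [← Finset.sum_div, Finset.sum_add_distrib]
    simp [h, h2]⟩

/-- A probability vector, as a law to sample from. -/
def sample (p : Simplex X) : PMF X :=
  PMF.ofFintype (fun x => ENNReal.ofReal (p x)) (by
    rw [← ENNReal.ofReal_sum_of_nonneg (fun x _ => stdSimplex.zero_le p x),
      stdSimplex.sum_eq_one, ENNReal.ofReal_one])

/-- The distance `‖p - q‖₁`. -/
def l1Dist (p q : Simplex X) : ℝ := ∑ x, |p x - q x|

/-- The distance `‖π - π'‖_TV = max_s ∑_a |π(a ∣ s) - π'(a ∣ s)|` of two policies. -/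
def tvDist (pol pol' : X → Simplex Y) : ℝ := ⨆ x, ∑ y, |pol x y - pol' x y|

/-- A row-stochastic family as a matrix. -/
def toMat (M : X → Simplex X) : Matrix X X ℝ := Matrix.of fun i j => M i j

/-- `net` is an `ε`-net of the simplex in the `ℓ¹` distance. -/
def IsNet (net : Finset (Simplex X)) (ε : ℝ) : Prop :=
  ∀ p : Simplex X, ∃ q ∈ net, l1Dist p q ≤ ε

/-- `proj` maps every probability vector to a nearest point of `net` (ties broken arbitrarily). -/
def IsProjection (net : Finset (Simplex X)) (proj : Simplex X → Simplex X) : Prop :=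
  ∀ p, proj p ∈ net ∧ ∀ q ∈ net, l1Dist p (proj p) ≤ l1Dist p q

end Vectors

/-! ### The mean-field game -/

/-- The data of the game: transition kernel `P(· ∣ s, a, μ)`, reward `R(s, a, μ) ∈ [0, 1]` and
discount factor `ρ`. -/
structure Game (S A : Type*) [Fintype S] where
  P : S → A → Simplex S → Simplex S
  R : S → A → Simplex S → ℝ
  R_mem : ∀ s a mf, R s a mf ∈ Set.Icc (0 : ℝ) 1
  ρ : ℝ
  ρ_pos : 0 < ρ
  ρ_lt_one : ρ < 1

section Game

variable {S A : Type*} [Fintype S] [Fintype A]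

/-- The matrix `P_{π,μ}(s,s') = ∑_a P(s' ∣ s, a, μ) π(a ∣ s)`. -/
def transMat (g : Game S A) (pol : S → Simplex A) (mf : Simplex S) : Matrix S S ℝ :=
  Matrix.of fun s s' => ∑ a, g.P s a mf s' * pol s a

/-- `openLoop g mf act s n s'` is the probability that the state after `n` transitions is `s'`,
if the mean-field is frozen at `mf`, the initial state is `s` and the prescribed actions
`act 0, act 1, …` are taken at the successive times. -/
def openLoop [DecidableEq S] (g : Game S A) (mf : Simplex S) (act : ℕ → A) (s : S) : ℕ → S → ℝ
  | 0 => fun s' => if s' = s then 1 else 0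
  | n + 1 => fun s' => ∑ x, openLoop g mf act s n x * g.P x (act n) mf s'

/-- The communicating condition: for every mean-field of the net there is a finite horizon from
which on, for every duration and every pair of states, some sequence of actions leads from the
first state to the second one with positive probability. -/
def Communicating [DecidableEq S] (g : Game S A) (net : Finset (Simplex S)) : Prop :=
  ∀ mf ∈ net, ∃ H : ℕ, ∀ s s' : S, ∀ n ≥ H, ∃ act : ℕ → A, 0 < openLoop g mf act s n s'

/-- Lipschitz continuity of `P_{π,μ}` in the policy (TV distance) and in the mean-field (`ℓ¹`
distance), for the Frobenius norm on matrices. -/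
def LipschitzTrans (g : Game S A) (Lpol Lmf : ℝ) : Prop :=
  (∀ (pol pol' : S → Simplex A) (mf : Simplex S),
    ‖transMat g pol mf - transMat g pol' mf‖ ≤ Lpol * tvDist pol pol') ∧
  (∀ (pol : S → Simplex A) (mf mf' : Simplex S),
    ‖transMat g pol mf - transMat g pol mf'‖ ≤ Lmf * l1Dist mf mf')

end Game

/-! ### The algorithm -/

/-- The coefficients `c_μ`, `c_π` of the learning rates and the exploration coefficient `ψ`. -/
structure Coeffs where
  cmf : ℝ
  cpol : ℝ
  ψ : ℝ
  cmf_pos : 0 < cmf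
  cmf_le_one : cmf ≤ 1
  cpol_pos : 0 < cpol
  cpol_le_one : cpol ≤ 1
  ψ_pos : 0 < ψ
  ψ_lt_one : ψ < 1

/-- The exponents `0 < θ < γ < 1 < ζ` of the learning rates, the inverse temperature `lam` of the
softmax, and the coefficient and exponent of the rate `β_t = c_β / (t + 1) ^ ν` of `Q`-learning. -/
structure Schedule where
  θ : ℝ
  γ : ℝ
  ζ : ℝ
  lam : ℝ
  cβ : ℝ
  ν : ℝ
  θ_pos : 0 < θ
  θ_lt_γ : θ < γ
  γ_lt_one : γ < 1
  one_lt_ζ : 1 < ζ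
  lam_pos : 0 < lam
  cβ_pos : 0 < cβ
  half_lt_ν : 1 / 2 < ν
  ν_le_one : ν ≤ 1

/-- The learning rate `c / k ^ η * (1 / t ^ ζ)`. -/
def rate (c η ζ : ℝ) (k t : ℕ) : ℝ := c / (k : ℝ) ^ η * (1 / (t : ℝ) ^ ζ)

lemma inv_natpow_le_one {η : ℝ} (hη : 0 < η) (k : ℕ) : 1 / (k : ℝ) ^ η ≤ 1 := by
  rcases Nat.eq_zero_or_pos k with rfl | hk
  · simp [Real.zero_rpow hη.ne']
  · have h1 : (1 : ℝ) ≤ (k : ℝ) := by exact_mod_cast hk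
    have h2 : (1 : ℝ) ≤ (k : ℝ) ^ η := Real.one_le_rpow h1 hη.le
    rw [div_le_one (by linarith)]
    exact h2

lemma rate_mem {c η ζ : ℝ} (hc : 0 < c) (hc1 : c ≤ 1) (hη : 0 < η) (hζ : 0 < ζ) (k t : ℕ) :
    rate c η ζ k t ∈ Set.Icc (0 : ℝ) 1 := by
  have h1 := inv_natpow_le_one hη k
  have h2 := inv_natpow_le_one hζ t
  have h3 : (0 : ℝ) ≤ 1 / (k : ℝ) ^ η := by positivity
  have h4 : (0 : ℝ) ≤ 1 / (t : ℝ) ^ ζ := by positivity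
  have h5 : rate c η ζ k t = c * (1 / (k : ℝ) ^ η) * (1 / (t : ℝ) ^ ζ) := by
    unfold rate
    ring
  rw [h5]
  exact ⟨by positivity,
    mul_le_one₀ (mul_le_one₀ hc1 h3 h1) h4 h2⟩

/-- `c^k_{μ,t} = c_μ k^{-γ} t^{-ζ}`. -/
def rateMf (cf : Coeffs) (sc : Schedule) (k t : ℕ) : unitInterval :=
  ⟨rate cf.cmf sc.γ sc.ζ k t, rate_mem cf.cmf_pos cf.cmf_le_one
    (sc.θ_pos.trans sc.θ_lt_γ) (one_pos.trans sc.one_lt_ζ) k t⟩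

/-- `c^k_{π,t} = c_π k^{-θ} t^{-ζ}`. -/
def ratePol (cf : Coeffs) (sc : Schedule) (k t : ℕ) : unitInterval :=
  ⟨rate cf.cpol sc.θ sc.ζ k t, rate_mem cf.cpol_pos cf.cpol_le_one
    sc.θ_pos (one_pos.trans sc.one_lt_ζ) k t⟩

/-- What the algorithm holds when timestep `t` of episode `k` begins: the current state `s^k_t`,
the mean-field `μ^k_{t-1}` and the policy `π^k_{t-1}`, the estimates `P̂^k_t` and `Q^k_t`, and the
numbers `N^k_{t-1}(i,j)` of transitions from `i` to `j` made so far in this episode. -/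
structure Memory (S A : Type*) [Fintype S] [Fintype A] where
  state : S
  mf : Simplex S
  pol : S → Simplex A
  Phat : S → Simplex S
  Q : S → A → ℝ
  count : S → S → ℕ

/-- The initialization: law of the initial state, and initial mean-field `μ^1_0`, policy `π^1_0`
and estimates `P̂^1_1`, `Q^1_1`. -/
structure Init (S A : Type*) [Fintype S] [Fintype A] where
  p₁ : Simplex S
  mf : Simplex S
  pol : S → Simplex A
  Phat : S → Simplex S
  Q : S → A → ℝ

section Algorithm

variable {S A : Type*} [Fintype S] [DecidableEq S] [Nonempty S]
  [Fintype A] [DecidableEq A] [Nonempty A]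

/-- The update of the mean-field to `μ^k_t`; it is projected onto the net at `t = 1` only. -/
def newMf (proj : Simplex S → Simplex S) (cf : Coeffs) (sc : Schedule) (k t : ℕ)
    (m : Memory S A) : Simplex S :=
  let x := mix (rateMf cf sc k t) m.mf (push m.Phat m.mf)
  if t = 1 then proj x else x

/-- The update of the policy to `π^k_t`; the barycenter is the uniform distribution on actions. -/
def newPol (cf : Coeffs) (sc : Schedule) (k t : ℕ) (m : Memory S A) (s : S) : Simplex A :=
  mix (ratePol cf sc k t) (m.pol s)
    (mix ⟨cf.ψ, cf.ψ_pos.le, cf.ψ_lt_one.le⟩ (softmax sc.lam (m.Q s)) stdSimplex.barycenter)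

/-- The memory after a timestep in which action `a` was taken and the next state is `s'`,
`mf'` and `pol'` being the updated mean-field and policy. -/
def record (g : Game S A) (sc : Schedule) (t : ℕ) (m : Memory S A)
    (mf' : Simplex S) (pol' : S → Simplex A) (a : A) (s' : S) : Memory S A :=
  let N : S → S → ℕ := fun i j => m.count i j + if i = m.state ∧ j = s' then 1 else 0
  let β : ℝ := sc.cβ / ((t : ℝ) + 1) ^ sc.ν
  { state := s'
    mf := mf'
    pol := pol'
    Phat := smoothed N
    Q := fun s b =>
      if s = m.state ∧ b = a then
        (1 - β) * m.Q s b + β * (g.R s b mf' + g.ρ * ⨆ b' : A, m.Q s' b')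
      else m.Q s b
    count := N }

/-- Timestep `t` of episode `k`: update mean-field and policy, draw the action from the updated
policy, draw the next state, and update the estimates. -/
def step (g : Game S A) (proj : Simplex S → Simplex S) (cf : Coeffs) (sc : Schedule) (k t : ℕ)
    (m : Memory S A) : PMF (Memory S A) :=
  (sample (newPol cf sc k t m m.state)).bind fun a =>
    (sample (g.P m.state a (newMf proj cf sc k t m))).map fun s' =>
      record g sc t m (newMf proj cf sc k t m) (newPol cf sc k t m) a s'

/-- The law of the memory after the timesteps `1, …, n` of episode `k`, if that episode begins
with memory `m`. -/
def runEpisode (g : Game S A) (proj : Simplex S → Simplex S) (cf : Coeffs) (sc : Schedule)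
    (k : ℕ) (m : Memory S A) : ℕ → PMF (Memory S A)
  | 0 => PMF.pure m
  | n + 1 => (runEpisode g proj cf sc k m n).bind (step g proj cf sc k (n + 1))

/-- The law of the memory after `k` complete episodes of `T` timesteps, that is, when episode
`k + 1` begins. Everything but the transition counts is carried over between episodes. -/
def afterEpisodes (g : Game S A) (proj : Simplex S → Simplex S) (cf : Coeffs) (sc : Schedule)
    (ini : Init S A) (T : ℕ) : ℕ → PMF (Memory S A)
  | 0 => (sample ini.p₁).map fun s =>
      { state := s, mf := ini.mf, pol := ini.pol, Phat := ini.Phat, Q := ini.Q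
        count := fun _ _ => 0 }
  | k + 1 => (afterEpisodes g proj cf sc ini T k).bind fun m =>
      (runEpisode g proj cf sc (k + 1) m T).map fun m' => { m' with count := fun _ _ => 0 }

/-- The law of the estimation error `ε^k_P = ‖P̂^k_T - P_{π^k_1, μ^k_1}‖_F` of episode `k ≥ 1`.
If the episode begins with memory `m`, then `μ^k_1` and `π^k_1` are the first updates
made from `m`, and `P̂^k_T` is the estimate held after `T - 1` further transitions. -/
def errorLaw (g : Game S A) (proj : Simplex S → Simplex S) (cf : Coeffs) (sc : Schedule)
    (ini : Init S A) (T k : ℕ) : PMF ℝ :=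
  (afterEpisodes g proj cf sc ini T (k - 1)).bind fun m =>
    (runEpisode g proj cf sc k m (T - 1)).map fun m' =>
      ‖toMat m'.Phat - transMat g (newPol cf sc k 1 m) (newMf proj cf sc k 1 m)‖

end Algorithm

end

end Sandbox

/-! Within an episode the learning rates from the second timestep on sum to `O(2^(1-ζ))` when `ζ ≥
2`. Hence all later policies and mean-fields stay that close to the first ones, and by the Lipschitz
hypothesis the state moves like a Markov chain whose one-step probabilities always lie within `D =
O(2^(1-ζ))` of the fixed matrix `M = P_{π^k_1, μ^k_1}` (`LipschitzTrans.driftLE`).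

This matrix mixes uniformly: `μ^k_1` has just been projected onto the finite net, and `π^k_1` plays
every action with probability at least `c_π ψ / A`, so the communicating condition gives `M ^ H ≥ η
> 0` entrywise with `H` and `η` the same for all episodes (`Communicating.exists_pow_ge`).

Two exponential supermartingales then do the work. The deviation `N(i,j) - N(i) M(i,j)` drifts by at
most `D` per step, so it exceeds `nD + 2√(nL)` with probability at most `e^(-L)`
(`toOuterMeasure_deviation_le`). The count `N(i)`, corrected by a solution of a Poisson equation for
`M`, grows by at least `η/2` per step on average, so `N(i) > ηn/8` up to an exponentially small
probability (`toOuterMeasure_rowCount_le`). Dividing one estimate by the other, with a union bound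
over pairs of states, yields an error of order `D + √(L/n) + 1/n`. All this holds for every memory
at the start of the episode, whence the uniformity in `k` and in the initialization. In the
remaining regimes (`ζ < 2`, large `D`, short episodes) the claimed bound exceeds the trivial bound
`S` on the error. -/

namespace Sandbox

open scoped ENNReal

noncomputable section

/-! ### Expectations under discrete laws -/

section Expectation

variable {α β : Type*}

/-- The expectation of a nonnegative function under a discrete law. -/
def expect (p : PMF α) (f : α → ℝ≥0∞) : ℝ≥0∞ := ∑' x, p x * f x

lemma expect_pure (a : α) (f : α → ℝ≥0∞) : expect (PMF.pure a) f = f a := by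
  unfold expect
  rw [tsum_eq_single a]
  · simp
  · intro b hb
    simp [PMF.pure_apply, hb]

lemma expect_bind (p : PMF α) (q : α → PMF β) (f : β → ℝ≥0∞) :
    expect (p.bind q) f = expect p fun a => expect (q a) f := by
  simp only [expect, PMF.bind_apply, ← ENNReal.tsum_mul_right, ← ENNReal.tsum_mul_left]
  rw [ENNReal.tsum_comm]
  simp only [mul_assoc]

lemma expect_map (p : PMF α) (q : α → β) (f : β → ℝ≥0∞) :
    expect (p.map q) f = expect p (f ∘ q) := by
  simp only [PMF.map, expect_bind, Function.comp_def, expect_pure]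

lemma expect_mono {p : PMF α} {f f' : α → ℝ≥0∞} (h : ∀ a ∈ p.support, f a ≤ f' a) :
    expect p f ≤ expect p f' := by
  refine ENNReal.tsum_le_tsum fun a => ?_
  by_cases ha : a ∈ p.support
  · gcongr
    exact h a ha
  · simp [(p.apply_eq_zero_iff a).2 ha]

lemma expect_mul_right (p : PMF α) (f : α → ℝ≥0∞) (c : ℝ≥0∞) :
    expect p (fun a => f a * c) = expect p f * c := by
  simp only [expect, ← ENNReal.tsum_mul_right, mul_assoc]

lemma expect_const (p : PMF α) (c : ℝ≥0∞) : expect p (fun _ => c) = c := by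
  simp [expect, ENNReal.tsum_mul_right]

/-- The exponential Markov inequality. -/
lemma toOuterMeasure_le_of_expect_exp_le {p : PMF α} {F : α → ℝ} {b u : ℝ}
    (h : expect p (fun a => ENNReal.ofReal (Real.exp (F a))) ≤ ENNReal.ofReal (Real.exp b)) :
    p.toOuterMeasure {a | u ≤ F a} ≤ ENNReal.ofReal (Real.exp (b - u)) := by
  have h1 : p.toOuterMeasure {a | u ≤ F a} ≤
      expect p fun a => ENNReal.ofReal (Real.exp (F a)) * ENNReal.ofReal (Real.exp (-u)) := by
    rw [PMF.toOuterMeasure_apply]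
    refine ENNReal.tsum_le_tsum fun a => ?_
    by_cases ha : u ≤ F a
    · rw [Set.indicator_of_mem (by exact ha)]
      beta_reduce
      rw [← ENNReal.ofReal_mul (Real.exp_pos _).le, ← Real.exp_add]
      refine le_mul_of_one_le_right' ?_
      rw [← ENNReal.ofReal_one]
      exact ENNReal.ofReal_le_ofReal (Real.one_le_exp (by linarith))
    · rw [Set.indicator_of_notMem (by exact ha)]
      exact zero_le
  rw [expect_mul_right] at h1
  refine h1.trans ((mul_le_mul_left h _).trans_eq ?_)
  rw [← ENNReal.ofReal_mul (Real.exp_pos _).le, ← Real.exp_add, sub_eq_add_neg]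

/-- Under a discrete law every set is additive with its complement, so memories need no σ-algebra.
-/
lemma toOuterMeasure_add_compl (p : PMF α) (s : Set α) :
    p.toOuterMeasure s + p.toOuterMeasure sᶜ = 1 := by
  rw [PMF.toOuterMeasure_apply, PMF.toOuterMeasure_apply, ← ENNReal.tsum_add, ← p.tsum_coe]
  congr 1 with a
  exact Set.indicator_self_add_compl_apply s p a

/-- Averaging over the first stage of a two-stage experiment preserves lower bounds of
probabilities. -/
lemma le_toMeasure_bind [MeasurableSpace β] {p : PMF α} {q : α → PMF β} {s : Set β}
    (hs : MeasurableSet s) {c : ℝ≥0∞} (h : ∀ a ∈ p.support, c ≤ (q a).toMeasure s) :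
    c ≤ (p.bind q).toMeasure s := by
  rw [PMF.toMeasure_bind_apply _ _ _ hs]
  calc c = expect p fun _ => c := (expect_const p c).symm
    _ ≤ expect p fun a => (q a).toMeasure s := expect_mono h

lemma expect_sample {X : Type*} [Fintype X] (p : Simplex X) {f : X → ℝ} (hf : ∀ x, 0 ≤ f x) :
    expect (sample p) (fun x => ENNReal.ofReal (f x)) = ENNReal.ofReal (∑ x, p x * f x) := by
  rw [expect, tsum_fintype, ENNReal.ofReal_sum_of_nonneg
    fun x _ => mul_nonneg (stdSimplex.zero_le p x) (hf x)]
  refine Finset.sum_congr rfl fun x _ => ?_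
  rw [ENNReal.ofReal_mul (stdSimplex.zero_le p x)]
  rfl

end Expectation

/-! ### Finite-dimensional estimates -/

section Estimates

variable {X Y : Type*} [Fintype X] [Fintype Y]

/-- The exponential moment of a variable with values in `[-1, 1]`. -/
lemma sum_mul_exp_le {q x : X → ℝ} (hq : ∀ i, 0 ≤ q i) (hq1 : ∑ i, q i = 1) {b c : ℝ}
    (hc : c ≤ 1) (hx : ∀ i, |x i| ≤ c) (hb : ∑ i, q i * x i ≤ b) :
    ∑ i, q i * Real.exp (x i) ≤ Real.exp (b + c ^ 2) := by
  -- `exp x ≤ 1 + x + x ^ 2` for `|x| ≤ 1`; after averaging, `1 + u ≤ exp u`.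
  have h1 : ∀ i, q i * Real.exp (x i) ≤ q i + q i * x i + q i * c ^ 2 := fun i => by
    have h2 := (abs_le.1 (Real.abs_exp_sub_one_sub_id_le ((hx i).trans hc))).2
    have h3 : x i ^ 2 ≤ c ^ 2 := sq_le_sq' (abs_le.1 (hx i)).1 (abs_le.1 (hx i)).2
    have h4 := mul_le_mul_of_nonneg_left (show Real.exp (x i) ≤ 1 + x i + c ^ 2 by linarith) (hq i)
    linarith
  have h2 := Finset.sum_le_sum fun i (_ : i ∈ Finset.univ) => h1 i
  rw [Finset.sum_add_distrib, Finset.sum_add_distrib, ← Finset.sum_mul, hq1] at h2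
  have h3 := Real.add_one_le_exp (b + c ^ 2)
  linarith

lemma frobenius_norm_le (M : Matrix X X ℝ) {b : ℝ} (hb : 0 ≤ b) (h : ∀ i j, |M i j| ≤ b) :
    ‖M‖ ≤ Fintype.card X * b := by
  rw [Matrix.frobenius_norm_def, ← Real.sqrt_eq_rpow]
  refine Real.sqrt_le_iff.2 ⟨by positivity, ?_⟩
  calc ∑ i, ∑ j, ‖M i j‖ ^ (2 : ℝ) ≤ ∑ _i : X, ∑ _j : X, b ^ 2 := by
        gcongr with i _ j _
        rw [Real.rpow_two]
        exact pow_le_pow_left₀ (norm_nonneg _) (h i j) 2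
    _ = (Fintype.card X * b) ^ 2 := by
        simp only [Finset.sum_const, Finset.card_univ, nsmul_eq_mul]
        ring

lemma abs_apply_le_frobenius_norm (M : Matrix X X ℝ) (i j : X) : |M i j| ≤ ‖M‖ := by
  rw [Matrix.frobenius_norm_def, ← Real.sqrt_eq_rpow]
  refine Real.le_sqrt_of_sq_le ?_
  have h1 : ∀ i j, 0 ≤ ‖M i j‖ ^ (2 : ℝ) := fun i j => by positivity
  calc |M i j| ^ 2 = ‖M i j‖ ^ (2 : ℝ) := by rw [Real.rpow_two, Real.norm_eq_abs]
    _ ≤ ∑ j, ‖M i j‖ ^ (2 : ℝ) :=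
        Finset.single_le_sum (f := fun j => ‖M i j‖ ^ (2 : ℝ)) (fun j _ => h1 i j)
          (Finset.mem_univ j)
    _ ≤ _ := Finset.single_le_sum (f := fun i => ∑ j, ‖M i j‖ ^ (2 : ℝ))
          (fun i _ => Finset.sum_nonneg fun j _ => h1 i j) (Finset.mem_univ i)

lemma l1Dist_nonneg (p q : Simplex X) : 0 ≤ l1Dist p q :=
  Finset.sum_nonneg fun _ _ => abs_nonneg _

lemma l1Dist_self (p : Simplex X) : l1Dist p p = 0 := by simp [l1Dist]

lemma l1Dist_mix_le (c : unitInterval) (p q r : Simplex X) :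
    l1Dist (mix c p q) r ≤ l1Dist p r + 2 * c := by
  have h : ∀ x, |mix c p q x - r x| ≤ |p x - r x| + (c * q x + c * p x) := fun x => by
    have h1 : mix c p q x - r x = (p x - r x) + (c * q x - c * p x) := by
      change (1 - (c : ℝ)) * p x + (c : ℝ) * q x - r x = _
      ring
    rw [h1]
    refine (abs_add_le _ _).trans (add_le_add_right (abs_le.2 ⟨?_, ?_⟩) _)
    · linarith [mul_nonneg c.2.1 (stdSimplex.zero_le q x)]
    · linarith [mul_nonneg c.2.1 (stdSimplex.zero_le p x)]
  refine (Finset.sum_le_sum fun x _ => h x).trans_eq ?_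
  rw [Finset.sum_add_distrib, Finset.sum_add_distrib, ← Finset.mul_sum, ← Finset.mul_sum,
    stdSimplex.sum_eq_one, stdSimplex.sum_eq_one, l1Dist]
  ring

lemma le_mix {c : unitInterval} {p q : Simplex X} {x : X} {b : ℝ} (hp : b ≤ p x) (hq : b ≤ q x) :
    b ≤ mix c p q x := by
  change b ≤ (1 - (c : ℝ)) * p x + (c : ℝ) * q x
  nlinarith [mul_le_mul_of_nonneg_left hp (sub_nonneg.2 c.2.2), mul_le_mul_of_nonneg_left hq c.2.1]

lemma mul_le_mix (c : unitInterval) (p q : Simplex X) (x : X) : c * q x ≤ mix c p q x := by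
  change (c : ℝ) * q x ≤ (1 - (c : ℝ)) * p x + (c : ℝ) * q x
  nlinarith [mul_nonneg (sub_nonneg.2 c.2.2) (stdSimplex.zero_le p x)]

end Estimates

/-! ### The transition matrices of the game -/

section TransitionMatrix

variable {S A : Type*} [Fintype S] [DecidableEq S] [Fintype A]

lemma transMat_mem_rowStochastic (g : Game S A) (pol : S → Simplex A) (mf : Simplex S) :
    transMat g pol mf ∈ Matrix.rowStochastic ℝ S := by
  refine Matrix.mem_rowStochastic_iff_sum.2 ⟨fun s s' => Finset.sum_nonneg fun a _ =>
    mul_nonneg (stdSimplex.zero_le _ s') (stdSimplex.zero_le _ a), fun s => ?_⟩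
  simp only [transMat, Matrix.of_apply]
  rw [Finset.sum_comm]
  simp [← Finset.sum_mul]

omit [Fintype A] in
lemma openLoop_nonneg (g : Game S A) (mf : Simplex S) (act : ℕ → A) (s : S) (n : ℕ) (s' : S) :
    0 ≤ openLoop g mf act s n s' := by
  induction n generalizing s' with
  | zero => unfold openLoop; split_ifs <;> norm_num
  | succ n ih =>
    exact Finset.sum_nonneg fun x _ => mul_nonneg (ih x) (stdSimplex.zero_le _ s')

/-- A policy that plays every action with probability at least `b` follows a given sequence of `n`
actions with probability at least `b ^ n`. -/
lemma pow_mul_openLoop_le (g : Game S A) {pol : S → Simplex A} (mf : Simplex S) {b : ℝ}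
    (hb : 0 ≤ b) (hpol : ∀ s a, b ≤ pol s a) (act : ℕ → A) (s : S) (n : ℕ) (s' : S) :
    b ^ n * openLoop g mf act s n s' ≤ (transMat g pol mf ^ n) s s' := by
  induction n generalizing s' with
  | zero => simp [openLoop, Matrix.one_apply, eq_comm]
  | succ n ih =>
    rw [pow_succ (transMat g pol mf), Matrix.mul_apply, openLoop, Finset.mul_sum]
    refine Finset.sum_le_sum fun x _ => ?_
    have h1 : b * g.P x (act n) mf s' ≤ transMat g pol mf x s' := by
      calc b * g.P x (act n) mf s' ≤ g.P x (act n) mf s' * pol x (act n) := by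
            rw [mul_comm]
            exact mul_le_mul_of_nonneg_left (hpol x _) (stdSimplex.zero_le _ _)
        _ ≤ ∑ a, g.P x a mf s' * pol x a :=
            Finset.single_le_sum (f := fun a => g.P x a mf s' * pol x a)
              (fun a _ => mul_nonneg (stdSimplex.zero_le _ _) (stdSimplex.zero_le _ _))
              (Finset.mem_univ _)
    have h2 := openLoop_nonneg g mf act s n x
    have h3 := stdSimplex.zero_le (g.P x (act n) mf) s'
    calc b ^ (n + 1) * (openLoop g mf act s n x * g.P x (act n) mf s')
        = (b ^ n * openLoop g mf act s n x) * (b * g.P x (act n) mf s') := by ring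
      _ ≤ (transMat g pol mf ^ n) s x * transMat g pol mf x s' :=
        mul_le_mul (ih x) h1 (by positivity)
          ((by positivity : 0 ≤ b ^ n * openLoop g mf act s n x).trans (ih x))

lemma exists_pos_forall_le {ι : Type*} (s : Finset ι) {f : ι → ℝ} (hf : ∀ i ∈ s, 0 < f i) :
    ∃ b, 0 < b ∧ ∀ i ∈ s, b ≤ f i := by
  rcases s.eq_empty_or_nonempty with rfl | hs
  · exact ⟨1, one_pos, by simp⟩
  · obtain ⟨i, hi, h⟩ := s.exists_min_image f hs
    exact ⟨f i, hf i hi, h⟩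

/-- In a communicating game the transition matrices of all policies with a given exploration rate,
at the mean-fields of the net, satisfy a Doeblin condition uniformly. -/
lemma Communicating.exists_pow_ge [Nonempty A] {g : Game S A} {net : Finset (Simplex S)}
    (h : Communicating g net) {b : ℝ} (hb : 0 < b) :
    ∃ (H : ℕ) (η : ℝ), 0 < η ∧ η ≤ 1 ∧ ∀ mf ∈ net, ∀ pol : S → Simplex A,
      (∀ s a, b ≤ pol s a) → ∀ s s', η ≤ (transMat g pol mf ^ H) s s' := by
  choose! H hH using h
  -- The condition holds for every duration beyond `H mf`, so one horizon serves the whole finite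
  -- net.
  set K := net.sup H with hK
  have h1 : ∀ mf s s', ∃ act : ℕ → A, mf ∈ net → 0 < openLoop g mf act s K s' := by
    intro mf s s'
    by_cases hmf : mf ∈ net
    · obtain ⟨act, hact⟩ := hH mf hmf s s' K (Finset.le_sup hmf)
      exact ⟨act, fun _ => hact⟩
    · exact ⟨fun _ => Classical.arbitrary A, fun h => absurd h hmf⟩
  choose act hact using h1
  obtain ⟨η, hη, hle⟩ := exists_pos_forall_le
    (net ×ˢ (Finset.univ : Finset (S × S)))
    (f := fun x => b ^ K * openLoop g x.1 (act x.1 x.2.1 x.2.2) x.2.1 K x.2.2)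
    (fun x hx => mul_pos (pow_pos hb _) (hact _ _ _ (Finset.mem_product.1 hx).1))
  refine ⟨K, min η 1, lt_min hη one_pos, min_le_right _ _, fun mf hmf pol hpol s s' => ?_⟩
  exact (min_le_left _ _).trans ((hle (mf, s, s') (by simp [hmf])).trans
    (pow_mul_openLoop_le g mf hb.le hpol _ s K s'))

/-- The expected number of visits to `i` at the times `0, …, H - 1`, for a Markov chain with
transition matrix `M` that starts from `s`. -/
def occupation (M : Matrix S S ℝ) (H : ℕ) (i s : S) : ℝ := ∑ r ∈ Finset.range H, (M ^ r) s i

lemma occupation_nonneg {M : Matrix S S ℝ} (hM : M ∈ Matrix.rowStochastic ℝ S) (H : ℕ) (i s : S) :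
    0 ≤ occupation M H i s :=
  Finset.sum_nonneg fun r _ => Matrix.nonneg_of_mem_rowStochastic (pow_mem hM r)

lemma occupation_le {M : Matrix S S ℝ} (hM : M ∈ Matrix.rowStochastic ℝ S) (H : ℕ) (i s : S) :
    occupation M H i s ≤ H :=
  (Finset.sum_le_sum fun r _ => Matrix.le_one_of_mem_rowStochastic (pow_mem hM r)).trans_eq
    (by simp)

/-- The sum defining `occupation` telescopes under `M`. With `v` the occupation function this is the
Poisson equation `1_i + M v - v = M ^ H 1_i`: under a Doeblin bound, visits to `i` corrected by `v`
increase by at least `η` on average from every state. -/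
lemma sum_mul_occupation (M : Matrix S S ℝ) (H : ℕ) (i s : S) :
    ∑ s', M s s' * occupation M H i s' =
      occupation M H i s + (M ^ H) s i - if s = i then 1 else 0 := by
  have h1 : ∑ s', M s s' * occupation M H i s' = ∑ r ∈ Finset.range H, (M ^ (r + 1)) s i := by
    simp only [occupation, Finset.mul_sum, pow_succ' M, Matrix.mul_apply]
    exact Finset.sum_comm
  have h2 := Finset.sum_range_succ (fun r => (M ^ r) s i) H
  rw [Finset.sum_range_succ'] at h2
  simp only [pow_zero, Matrix.one_apply] at h2
  rw [h1, occupation]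
  linarith

omit [DecidableEq S] in
lemma LipschitzTrans.abs_transMat_sub_le [Nonempty S] {g : Game S A} {Lpol Lmf : ℝ}
    (h : LipschitzTrans g Lpol Lmf) {pol pol' : S → Simplex A} {mf mf' : Simplex S} {d : ℝ}
    (hpol : ∀ s, l1Dist (pol s) (pol' s) ≤ d) (hmf : l1Dist mf mf' ≤ d) (s s' : S) :
    |transMat g pol mf s s' - transMat g pol' mf' s s'| ≤ (|Lpol| + |Lmf|) * d := by
  have h1 : tvDist pol pol' ≤ d := ciSup_le hpol
  have h1' : 0 ≤ tvDist pol pol' := Real.iSup_nonneg fun s => l1Dist_nonneg _ _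
  have h2 : |transMat g pol mf s s' - transMat g pol' mf s s'| ≤ |Lpol| * d :=
    (abs_apply_le_frobenius_norm (transMat g pol mf - transMat g pol' mf) s s').trans <|
      (h.1 pol pol' mf).trans <|
        mul_le_mul (le_abs_self _) h1 h1' (abs_nonneg _)
  have h3 : |transMat g pol' mf s s' - transMat g pol' mf' s s'| ≤ |Lmf| * d :=
    (abs_apply_le_frobenius_norm (transMat g pol' mf - transMat g pol' mf') s s').trans <|
      (h.2 pol' mf mf').trans <|
        mul_le_mul (le_abs_self _) hmf (l1Dist_nonneg _ _) (abs_nonneg _)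
  have h4 := abs_sub_le (transMat g pol mf s s') (transMat g pol' mf s s')
    (transMat g pol' mf' s s')
  linarith

end TransitionMatrix

/-! ### Learning rates -/

lemma rate_le {c η ζ : ℝ} (hc1 : c ≤ 1) (hη : 0 < η) (k t : ℕ) :
    rate c η ζ k t ≤ 1 / (t : ℝ) ^ ζ := by
  have h1 : c / (k : ℝ) ^ η ≤ 1 := by
    rw [div_eq_mul_one_div]
    exact mul_le_one₀ hc1 (by positivity) (inv_natpow_le_one hη k)
  have h2 : 0 ≤ 1 / (t : ℝ) ^ ζ := by positivity
  exact mul_le_of_le_one_left h2 h1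

/-- The rates from the second timestep on are dominated by the increments of a sequence with values
in `[0, 4 * 2 ^ (1 - ζ)]`. -/
lemma two_mul_rate_le {c η ζ : ℝ} (hc1 : c ≤ 1) (hη : 0 < η) (hζ : 2 ≤ ζ) (k n : ℕ) :
    2 * rate c η ζ k (n + 2) ≤
      4 * (2 : ℝ) ^ (1 - ζ) * (1 / ((n : ℝ) + 1) - 1 / ((n : ℝ) + 2)) := by
  have h1 := rate_le (ζ := ζ) hc1 hη k (n + 2)
  have hn : (0 : ℝ) ≤ n := n.cast_nonneg
  -- Since the base is at least `1` and `ζ ≥ 2`, this gives `t ^ (-ζ) ≤ 2 ^ (-ζ) * 4 / t ^ 2` for `t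
  -- = n + 2`: the factor `2 ^ (-ζ)` comes out of a sum that telescopes by `h6`.
  have h2 : (((n : ℝ) + 2) / 2) ^ (2 : ℝ) ≤ (((n : ℝ) + 2) / 2) ^ ζ :=
    Real.rpow_le_rpow_of_exponent_le (by linarith) hζ
  rw [Real.div_rpow (by positivity) (by positivity) ζ, Real.rpow_two] at h2
  have h3 : (0 : ℝ) < 2 ^ ζ := by positivity
  have h4 : (2 : ℝ) ^ (1 - ζ) = 2 / 2 ^ ζ := by rw [Real.rpow_sub two_pos, Real.rpow_one]
  rw [le_div_iff₀ h3] at h2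
  have h5 : 1 / ((n : ℝ) + 2) ^ ζ ≤ 1 / ((((n : ℝ) + 2) / 2) ^ 2 * 2 ^ ζ) :=
    one_div_le_one_div_of_le (by positivity) h2
  have h6 : 1 / ((n : ℝ) + 2) ^ 2 ≤ 1 / ((n : ℝ) + 1) - 1 / ((n : ℝ) + 2) := by
    rw [div_sub_div _ _ (by positivity) (by positivity), div_le_div_iff₀ (by positivity)
      (by positivity)]
    nlinarith
  have h7 : 1 / ((((n : ℝ) + 2) / 2) ^ 2 * 2 ^ ζ) = 4 * (1 / 2 ^ ζ) * (1 / ((n : ℝ) + 2) ^ 2) := by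
    field_simp
    norm_num
  push_cast at h1
  calc 2 * rate c η ζ k (n + 2) ≤ 2 * (4 * (1 / 2 ^ ζ) * (1 / ((n : ℝ) + 2) ^ 2)) := by linarith
    _ ≤ 2 * (4 * (1 / 2 ^ ζ) * (1 / ((n : ℝ) + 1) - 1 / ((n : ℝ) + 2))) := by gcongr
    _ = _ := by rw [h4]; ring

/-! ### The steps of the algorithm -/

section Steps

variable {S A : Type*} [Fintype S] [DecidableEq S] [Nonempty S]
  [Fintype A] [DecidableEq A] [Nonempty A]
  {g : Game S A} {proj : Simplex S → Simplex S} {cf : Coeffs} {sc : Schedule}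

/-- The transition counts after a further transition from `x` to `y`. -/
def addTransition (N : S → S → ℕ) (x y : S) : S → S → ℕ :=
  fun i j => N i j + if i = x ∧ j = y then 1 else 0

lemma exists_of_mem_support_step {k t : ℕ} {m m' : Memory S A}
    (h : m' ∈ (step g proj cf sc k t m).support) :
    ∃ a s', m' = record g sc t m (newMf proj cf sc k t m) (newPol cf sc k t m) a s' := by
  simp only [step, PMF.mem_support_bind_iff, PMF.mem_support_map_iff] at h
  obtain ⟨a, -, s', -, h⟩ := h
  exact ⟨a, s', h.symm⟩

/-- A timestep moves the state according to `P_{π,μ}`, for the updated policy and mean-field. -/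
lemma expect_step (k t : ℕ) (m : Memory S A) {φ : S → (S → S → ℕ) → ℝ} (hφ : ∀ s N, 0 ≤ φ s N) :
    expect (step g proj cf sc k t m) (fun m' => ENNReal.ofReal (φ m'.state m'.count)) =
      ENNReal.ofReal (∑ s', transMat g (newPol cf sc k t m) (newMf proj cf sc k t m) m.state s' *
        φ s' (addTransition m.count m.state s')) := by
  have h1 : ∀ a, expect ((sample (g.P m.state a (newMf proj cf sc k t m))).map fun s' =>
        record g sc t m (newMf proj cf sc k t m) (newPol cf sc k t m) a s')
        (fun m' => ENNReal.ofReal (φ m'.state m'.count)) =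
      ENNReal.ofReal (∑ s', g.P m.state a (newMf proj cf sc k t m) s' *
        φ s' (addTransition m.count m.state s')) := fun a => by
    rw [expect_map]
    exact expect_sample _ fun s' => hφ _ _
  rw [step, expect_bind]
  simp only [h1]
  rw [expect_sample _ fun a => Finset.sum_nonneg fun s' _ =>
    mul_nonneg (stdSimplex.zero_le _ _) (hφ _ _)]
  congr 1
  simp only [transMat, Matrix.of_apply, Finset.mul_sum, Finset.sum_mul]
  rw [Finset.sum_comm]
  refine Finset.sum_congr rfl fun s' _ => Finset.sum_congr rfl fun a _ => by ring

/-- The one-step bound for the exponential moment of a function with bounded increments. -/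
lemma expect_step_exp_le (k t : ℕ) (m : Memory S A) {φ : S → (S → S → ℕ) → ℝ} {b c : ℝ}
    (hc : c ≤ 1)
    (hφ : ∀ s', |φ s' (addTransition m.count m.state s') - φ m.state m.count| ≤ c)
    (hb : ∑ s', transMat g (newPol cf sc k t m) (newMf proj cf sc k t m) m.state s' *
      (φ s' (addTransition m.count m.state s') - φ m.state m.count) ≤ b) :
    expect (step g proj cf sc k t m)
        (fun m' => ENNReal.ofReal (Real.exp (φ m'.state m'.count))) ≤
      ENNReal.ofReal (Real.exp (φ m.state m.count + (b + c ^ 2))) := by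
  have hM := transMat_mem_rowStochastic g (newPol cf sc k t m) (newMf proj cf sc k t m)
  rw [expect_step k t m (φ := fun s N => Real.exp (φ s N)) fun s N => (Real.exp_pos _).le]
  refine ENNReal.ofReal_le_ofReal ?_
  have h1 := mul_le_mul_of_nonneg_left
    (sum_mul_exp_le (fun s' => Matrix.nonneg_of_mem_rowStochastic hM)
      (Matrix.sum_row_of_mem_rowStochastic hM m.state) hc hφ hb)
    (Real.exp_pos (φ m.state m.count)).le
  rw [← Real.exp_add, Finset.mul_sum] at h1
  refine le_trans (le_of_eq (Finset.sum_congr rfl fun s' _ => ?_)) h1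
  rw [mul_left_comm, ← Real.exp_add]
  congr 2
  ring

lemma runEpisode_induction {k : ℕ} {m : Memory S A} {J : ℕ → Memory S A → Prop} (h0 : J 0 m)
    (hs : ∀ n m' m'', J n m' → m'' ∈ (step g proj cf sc k (n + 1) m').support → J (n + 1) m'') :
    ∀ n, ∀ m' ∈ (runEpisode g proj cf sc k m n).support, J n m' := by
  intro n
  induction n with
  | zero =>
    intro m' hm'
    rw [runEpisode, PMF.support_pure, Set.mem_singleton_iff] at hm'
    exact hm' ▸ h0
  | succ n ih =>
    intro m'' hm''
    rw [runEpisode, PMF.mem_support_bind_iff] at hm''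
    obtain ⟨m', hm', h⟩ := hm''
    exact hs n m' m'' (ih m' hm') h

/-- Supermartingale argument: a one-step bound, needed only at reachable memories, is iterated along
the episode. -/
lemma expect_runEpisode_exp_le {k : ℕ} {m : Memory S A} {F : Memory S A → ℝ} {c : ℝ}
    (h : ∀ n, ∀ m' ∈ (runEpisode g proj cf sc k m n).support,
      expect (step g proj cf sc k (n + 1) m') (fun m'' => ENNReal.ofReal (Real.exp (F m''))) ≤
        ENNReal.ofReal (Real.exp (F m' + c))) (n : ℕ) :
    expect (runEpisode g proj cf sc k m n) (fun m' => ENNReal.ofReal (Real.exp (F m'))) ≤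
      ENNReal.ofReal (Real.exp (F m + n * c)) := by
  induction n with
  | zero => simp [runEpisode, expect_pure]
  | succ n ih =>
    rw [runEpisode, expect_bind]
    refine (expect_mono (h n)).trans ?_
    have h1 : ∀ x : Memory S A, ENNReal.ofReal (Real.exp (F x + c)) =
        ENNReal.ofReal (Real.exp (F x)) * ENNReal.ofReal (Real.exp c) := fun x => by
      rw [Real.exp_add, ENNReal.ofReal_mul (Real.exp_pos _).le]
    simp only [h1]
    rw [expect_mul_right]
    refine (mul_le_mul_left ih _).trans_eq ?_
    rw [← ENNReal.ofReal_mul (Real.exp_pos _).le, ← Real.exp_add]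
    congr 2
    push_cast
    ring

/-- The estimate held after at least one timestep is the smoothed empirical transition matrix. -/
lemma Phat_eq_of_mem_support_runEpisode {k n : ℕ} {m m' : Memory S A} (hn : 1 ≤ n)
    (h : m' ∈ (runEpisode g proj cf sc k m n).support) : m'.Phat = smoothed m'.count := by
  refine runEpisode_induction (J := fun n m' => 1 ≤ n → m'.Phat = smoothed m'.count)
    (fun h => by omega) (fun n m' m'' _ h _ => ?_) n m' h hn
  obtain ⟨a, s', rfl⟩ := exists_of_mem_support_step h
  rfl

omit [DecidableEq S] [Nonempty S] [DecidableEq A] [Nonempty A] in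
lemma newMf_succ (k n : ℕ) (m : Memory S A) :
    newMf proj cf sc k (n + 2) m = mix (rateMf cf sc k (n + 2)) m.mf (push m.Phat m.mf) := by
  simp [newMf]

/-- Within an episode the mean-field and the policy stay close to the first ones. -/
lemma l1Dist_le_of_mem_support_runEpisode (hζ : 2 ≤ sc.ζ) {k n : ℕ} {m m' : Memory S A}
    (h : m' ∈ (runEpisode g proj cf sc k m n).support) :
    l1Dist (newMf proj cf sc k (n + 1) m') (newMf proj cf sc k 1 m) ≤ 4 * (2 : ℝ) ^ (1 - sc.ζ) ∧
    ∀ s, l1Dist (newPol cf sc k (n + 1) m' s) (newPol cf sc k 1 m s) ≤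
      4 * (2 : ℝ) ^ (1 - sc.ζ) := by
  -- The factor `1 - 1 / (n + 1)` strengthens the bound so that the increments of `two_mul_rate_le`
  -- telescope. It vanishes at `n = 0`; the projection, being part of the first update, adds nothing
  -- to the drift.
  have key := runEpisode_induction (g := g) (proj := proj) (cf := cf) (sc := sc) (k := k) (m := m)
    (J := fun n m' =>
      l1Dist (newMf proj cf sc k (n + 1) m') (newMf proj cf sc k 1 m) ≤
        4 * (2 : ℝ) ^ (1 - sc.ζ) * (1 - 1 / ((n : ℝ) + 1)) ∧
      ∀ s, l1Dist (newPol cf sc k (n + 1) m' s) (newPol cf sc k 1 m s) ≤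
        4 * (2 : ℝ) ^ (1 - sc.ζ) * (1 - 1 / ((n : ℝ) + 1)))
    (by simp [l1Dist_self]) ?_ n m' h
  · have h1 : 4 * (2 : ℝ) ^ (1 - sc.ζ) * (1 - 1 / ((n : ℝ) + 1)) ≤ 4 * (2 : ℝ) ^ (1 - sc.ζ) :=
      mul_le_of_le_one_right (by positivity) (sub_le_self _ (by positivity))
    exact ⟨key.1.trans h1, fun s => (key.2 s).trans h1⟩
  · rintro n m' m'' ⟨hmf, hpol⟩ hm''
    obtain ⟨a, s', rfl⟩ := exists_of_mem_support_step hm''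
    have h1 : 2 * (rateMf cf sc k (n + 2) : ℝ) ≤ _ :=
      two_mul_rate_le cf.cmf_le_one (sc.θ_pos.trans sc.θ_lt_γ) hζ k n
    have h2 : 2 * (ratePol cf sc k (n + 2) : ℝ) ≤ _ :=
      two_mul_rate_le cf.cpol_le_one sc.θ_pos hζ k n
    push_cast
    rw [add_assoc (n : ℝ) 1 1, one_add_one_eq_two]
    refine ⟨?_, fun s => ?_⟩
    · rw [newMf_succ]
      refine (l1Dist_mix_le _ _ _ _).trans ?_
      change l1Dist (newMf proj cf sc k (n + 1) m') _ + _ ≤ _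
      linarith
    · refine (l1Dist_mix_le _ _ _ _).trans ?_
      change l1Dist (newPol cf sc k (n + 1) m' s) _ + _ ≤ _
      linarith [hpol s]

/-- The least probability with which the policies explore. -/
def exploration (A : Type*) [Fintype A] (cf : Coeffs) : ℝ := cf.cpol * (cf.ψ / Fintype.card A)

omit [DecidableEq A] in
lemma exploration_pos : 0 < exploration A cf :=
  mul_pos cf.cpol_pos (div_pos cf.ψ_pos (Nat.cast_pos.2 Fintype.card_pos))

omit [DecidableEq A] in
lemma div_card_le_mix_barycenter (p : Simplex A) (a : A) :
    cf.ψ / Fintype.card A ≤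
      mix ⟨cf.ψ, cf.ψ_pos.le, cf.ψ_lt_one.le⟩ p stdSimplex.barycenter a :=
  (div_eq_mul_inv _ _).trans_le (mul_le_mix ⟨cf.ψ, cf.ψ_pos.le, cf.ψ_lt_one.le⟩ p stdSimplex.barycenter a)

omit [DecidableEq S] [Nonempty S] [DecidableEq A] in
-- A mixture of two policies that both explore explores. The initial policy need not, but the first
-- rate `c_π` of the first episode already mixes in enough of the uniform law.
lemma exploration_le_newPol {k t : ℕ} {m : Memory S A}
    (h : (∀ s a, exploration A cf ≤ m.pol s a) ∨ (k = 1 ∧ t = 1)) (s : S) (a : A) :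
    exploration A cf ≤ newPol cf sc k t m s a := by
  have h0 : 0 ≤ cf.ψ / Fintype.card A := div_nonneg cf.ψ_pos.le (Nat.cast_nonneg _)
  have h1 := div_card_le_mix_barycenter (cf := cf) (softmax sc.lam (m.Q s)) a
  rcases h with h | ⟨rfl, rfl⟩
  · exact le_mix (h s a) ((mul_le_of_le_one_left h0 cf.cpol_le_one).trans h1)
  · refine le_trans ?_ (mul_le_mix _ _ _ _)
    have h2 : (ratePol cf sc 1 1 : ℝ) = cf.cpol := by simp [ratePol, rate]
    rw [h2]
    exact mul_le_mul_of_nonneg_left h1 cf.cpol_pos.le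

lemma exploration_le_pol_of_mem_support_runEpisode {k n : ℕ} {m m' : Memory S A}
    (h : (∀ s a, exploration A cf ≤ m.pol s a) ∨ k = 1) (hn : 1 ≤ n)
    (hm' : m' ∈ (runEpisode g proj cf sc k m n).support) (s : S) (a : A) :
    exploration A cf ≤ m'.pol s a := by
  refine (runEpisode_induction (J := fun n m' =>
    (∀ s a, exploration A cf ≤ m'.pol s a) ∨ (k = 1 ∧ n = 0)) (by simpa using h)
    (fun n m' m'' hJ hm'' => ?_) n m' hm').elim (fun h => h s a) (fun h => by omega)
  obtain ⟨a, s', rfl⟩ := exists_of_mem_support_step hm''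
  exact Or.inl (exploration_le_newPol (by simpa using hJ))

/-- When an episode begins, no transition has been counted and, unless it is the first episode,
the policy explores. -/
lemma of_mem_support_afterEpisodes {ini : Init S A} {T k : ℕ} (hT : 1 ≤ T) {m : Memory S A}
    (h : m ∈ (afterEpisodes g proj cf sc ini T k).support) :
    m.count = 0 ∧ ((∀ s a, exploration A cf ≤ m.pol s a) ∨ k = 0) := by
  induction k generalizing m with
  | zero =>
    rw [afterEpisodes, PMF.mem_support_map_iff] at h
    obtain ⟨s, -, rfl⟩ := h
    exact ⟨rfl, Or.inr rfl⟩
  | succ k ih =>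
    rw [afterEpisodes, PMF.mem_support_bind_iff] at h
    obtain ⟨m', hm', h⟩ := h
    rw [PMF.mem_support_map_iff] at h
    obtain ⟨m'', hm'', rfl⟩ := h
    exact ⟨rfl, Or.inl fun s a => exploration_le_pol_of_mem_support_runEpisode
      ((ih hm').2.imp_right (by omega)) hT hm'' s a⟩

end Steps

/-! ### Concentration within an episode -/

section Concentration

variable {S A : Type*} [Fintype S] [DecidableEq S] [Nonempty S]
  [Fintype A] [DecidableEq A] [Nonempty A]
  {g : Game S A} {proj : Simplex S → Simplex S} {cf : Coeffs} {sc : Schedule}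

/-- The number of transitions from `i`. -/
def rowCount (N : S → S → ℕ) (i : S) : ℝ := ∑ j, (N i j : ℝ)

omit [DecidableEq S] [Nonempty S] in
lemma rowCount_nonneg (N : S → S → ℕ) (i : S) : 0 ≤ rowCount N i :=
  Finset.sum_nonneg fun _ _ => Nat.cast_nonneg _

omit [Nonempty S] in
lemma rowCount_addTransition (N : S → S → ℕ) (x y i : S) :
    rowCount (addTransition N x y) i = rowCount N i + if x = i then 1 else 0 := by
  simp only [rowCount, addTransition, Nat.cast_add, Finset.sum_add_distrib]
  congr 1
  by_cases h : x = i
  · subst h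
    simp
  · simp [h, Ne.symm h]

omit [Fintype S] [Nonempty S] in
lemma addTransition_apply (N : S → S → ℕ) (x y i j : S) :
    (addTransition N x y i j : ℝ) = N i j + if x = i then (if y = j then 1 else 0) else 0 := by
  by_cases h : x = i
  · subst h
    simp [addTransition, eq_comm]
  · simp [addTransition, h, Ne.symm h]

/-- In the first `n` timesteps of the episode that begins with memory `m`, the transition
probabilities differ by at most `D` from those of the first timestep. -/
def DriftLE (g : Game S A) (proj : Simplex S → Simplex S) (cf : Coeffs) (sc : Schedule)
    (k : ℕ) (m : Memory S A) (M : Matrix S S ℝ) (D : ℝ) : Prop :=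
  ∀ n, ∀ m' ∈ (runEpisode g proj cf sc k m n).support, ∀ s s',
    |transMat g (newPol cf sc k (n + 1) m') (newMf proj cf sc k (n + 1) m') s s' - M s s'| ≤ D

/-- Exponential inequality for the deviation of the number of transitions from `i` to `j`. -/
lemma toOuterMeasure_deviation_le {k : ℕ} {m : Memory S A} (hm : m.count = 0)
    {M : Matrix S S ℝ} (hM : M ∈ Matrix.rowStochastic ℝ S) {D : ℝ}
    (hD : DriftLE g proj cf sc k m M D) {n : ℕ} {L : ℝ} (hL : 0 ≤ L) (hLn : L ≤ n) (hn : 1 ≤ n)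
    {σ : ℝ} (hσ : |σ| = 1) (i j : S) :
    (runEpisode g proj cf sc k m n).toOuterMeasure
        {m' | n * D + 2 * √(n * L) ≤ σ * (m'.count i j - rowCount m'.count i * M i j)} ≤
      ENNReal.ofReal (Real.exp (-L)) := by
  have hn0 : (0 : ℝ) < n := Nat.cast_pos.2 hn
  -- The optimal tilt: the exponent `n (cD + c ^ 2) - c (nD + 2√(nL))` equals `-L`, and `L ≤ n`
  -- makes `c ≤ 1`.
  set c : ℝ := √(L / n) with hc
  have hc0 : 0 ≤ c := Real.sqrt_nonneg _
  have hc1 : c ≤ 1 := Real.sqrt_le_one.2 ((div_le_one hn0).2 hLn)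
  set φ : S → (S → S → ℕ) → ℝ := fun _ N => c * (σ * (N i j - rowCount N i * M i j)) with hφ
  have hinc : ∀ (N : S → S → ℕ) (x y : S), φ y (addTransition N x y) - φ x N =
      if x = i then c * (σ * ((if y = j then 1 else 0) - M i j)) else 0 := fun N x y => by
    simp only [hφ, rowCount_addTransition, addTransition_apply]
    split_ifs <;> ring
  have hstep : ∀ n, ∀ m' ∈ (runEpisode g proj cf sc k m n).support,
      expect (step g proj cf sc k (n + 1) m')
        (fun m'' => ENNReal.ofReal (Real.exp (φ m''.state m''.count))) ≤
      ENNReal.ofReal (Real.exp (φ m'.state m'.count + (c * D + c ^ 2))) := by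
    intro n m' hm'
    have hD' := hD n m' hm'
    have hD0 : 0 ≤ D := (abs_nonneg _).trans (hD' i j)
    have hq := transMat_mem_rowStochastic g (newPol cf sc k (n + 1) m')
      (newMf proj cf sc k (n + 1) m')
    refine expect_step_exp_le (k := k) (t := n + 1) (m := m') hc1 (fun s' => ?_) ?_
    · rw [hinc]
      split_ifs with h1 h2
      · rw [abs_mul, abs_mul, hσ, one_mul, abs_of_nonneg hc0]
        refine mul_le_of_le_one_right hc0 (abs_le.2 ⟨?_, ?_⟩) <;>
        linarith [Matrix.nonneg_of_mem_rowStochastic hM (i := i) (j := j),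
          Matrix.le_one_of_mem_rowStochastic hM (i := i) (j := j)]
      · rw [abs_mul, abs_mul, hσ, one_mul, abs_of_nonneg hc0]
        refine mul_le_of_le_one_right hc0 (abs_le.2 ⟨?_, ?_⟩) <;>
        linarith [Matrix.nonneg_of_mem_rowStochastic hM (i := i) (j := j),
          Matrix.le_one_of_mem_rowStochastic hM (i := i) (j := j)]
      · simpa using hc0
    · simp only [hinc]
      by_cases h : m'.state = i
      · simp only [h, if_true, mul_sub, Finset.sum_sub_distrib]
        rw [← Finset.sum_mul, Matrix.sum_row_of_mem_rowStochastic hq]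
        simp only [mul_ite, mul_one, mul_zero, Finset.sum_ite_eq', Finset.mem_univ, if_true]
        have h1 := le_abs_self (σ * (transMat g (newPol cf sc k (n + 1) m')
          (newMf proj cf sc k (n + 1) m') i j - M i j))
        rw [abs_mul, hσ, one_mul] at h1
        have h2 := mul_le_mul_of_nonneg_left (h1.trans (hD' i j)) hc0
        linarith
      · simp only [h, if_false, mul_zero, Finset.sum_const_zero]
        positivity
  have h1 := toOuterMeasure_le_of_expect_exp_le (u := c * (n * D + 2 * √(n * L)))
    (expect_runEpisode_exp_le (F := fun m' => φ m'.state m'.count) hstep n)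
  refine (PMF.toOuterMeasure_mono _ ?_).trans (h1.trans (ENNReal.ofReal_le_ofReal ?_))
  · rintro m' ⟨hm', -⟩
    exact mul_le_mul_of_nonneg_left hm' hc0
  · refine Real.exp_le_exp.2 (le_of_eq ?_)
    have h2 : φ m.state m.count = 0 := by simp [hφ, hm, rowCount]
    have h3 : n * c ^ 2 = L := by
      rw [hc, Real.sq_sqrt (by positivity)]
      field_simp
    have h4 : c * √(n * L) = L := by
      rw [hc, ← Real.sqrt_mul (by positivity)]
      rw [show L / n * (n * L) = L ^ 2 by field_simp]
      exact Real.sqrt_sq hL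
    rw [h2]
    linear_combination h3 - 2 * h4

/-- Under a Doeblin condition every state is visited a positive fraction of the time, up to an
exponentially small probability. -/
lemma toOuterMeasure_rowCount_le {k : ℕ} {m : Memory S A}
    {M : Matrix S S ℝ} (hM : M ∈ Matrix.rowStochastic ℝ S) {D : ℝ}
    (hD : DriftLE g proj cf sc k m M D) {H : ℕ} {η : ℝ} (hη : 0 < η) (hη1 : η ≤ 1)
    (hH : ∀ s s', η ≤ (M ^ H) s s') (hDH : Fintype.card S * D * H ≤ η / 2) (n : ℕ) (i : S) :
    (runEpisode g proj cf sc k m n).toOuterMeasure {m' | rowCount m'.count i ≤ η * n / 8} ≤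
      ENNReal.ofReal (Real.exp (1 - η / (4 * (1 + (H : ℝ)) ^ 2) * η * n / 8)) := by
  have hH1 : (1 : ℝ) ≤ 1 + H := by simp
  -- Chosen so that the second-order term `(c (1 + H)) ^ 2` is `cη/4`, half of the gain `cη/2` from
  -- the drift.
  set c : ℝ := η / (4 * (1 + (H : ℝ)) ^ 2) with hc
  have hc0 : 0 < c := by positivity
  have hcH : c * (1 + H) ≤ 1 := by
    rw [hc, div_mul_eq_mul_div, div_le_one (by positivity)]
    nlinarith
  have hcc : (c * (1 + H)) ^ 2 = c * η / 4 := by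
    rw [hc]
    field_simp
  set v := occupation M H i with hv
  have hv0 : ∀ s, 0 ≤ v s := occupation_nonneg hM H i
  have hvH : ∀ s, v s ≤ H := occupation_le hM H i
  set φ : S → (S → S → ℕ) → ℝ := fun s N => -(c * (rowCount N i + v s)) with hφ
  have hinc : ∀ (N : S → S → ℕ) (x y : S), φ y (addTransition N x y) - φ x N =
      -(c * ((if x = i then 1 else 0) + v y - v x)) := fun N x y => by
    simp only [hφ, rowCount_addTransition]
    ring
  have hstep : ∀ n, ∀ m' ∈ (runEpisode g proj cf sc k m n).support,
      expect (step g proj cf sc k (n + 1) m')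
        (fun m'' => ENNReal.ofReal (Real.exp (φ m''.state m''.count))) ≤
      ENNReal.ofReal (Real.exp (φ m'.state m'.count + (-(c * (η / 2)) + (c * (1 + H)) ^ 2))) := by
    intro n m' hm'
    have hq := transMat_mem_rowStochastic g (newPol cf sc k (n + 1) m')
      (newMf proj cf sc k (n + 1) m')
    have hD' := hD n m' hm' m'.state
    refine expect_step_exp_le (k := k) (t := n + 1) (m := m') hcH (fun s' => ?_) ?_
    · rw [hinc, abs_neg, abs_mul, abs_of_pos hc0]
      refine mul_le_mul_of_nonneg_left (abs_le.2 ?_) hc0.le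
      split_ifs <;> constructor <;> linarith [hv0 s', hv0 m'.state, hvH s', hvH m'.state]
    · set q := transMat g (newPol cf sc k (n + 1) m') (newMf proj cf sc k (n + 1) m')
      have h1 : ∀ s', (M m'.state s' - D) * v s' ≤ q m'.state s' * v s' := fun s' =>
        mul_le_mul_of_nonneg_right (by linarith [(abs_le.1 (hD' s')).1]) (hv0 s')
      have h2 := Finset.sum_le_sum fun s' (_ : s' ∈ Finset.univ) => h1 s'
      simp only [sub_mul, Finset.sum_sub_distrib] at h2
      -- By the Poisson equation the mean increment of `rowCount + v` under `M` is at least `η`;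
      -- replacing `M` by the actual probabilities costs at most `S * D * H ≤ η / 2`.
      rw [hv, sum_mul_occupation, ← hv, ← Finset.mul_sum] at h2
      have h3 : ∑ s', v s' ≤ Fintype.card S * H :=
        (Finset.sum_le_sum fun s' _ => hvH s').trans_eq (by simp)
      have hD0 : 0 ≤ D := (abs_nonneg _).trans (hD' i)
      have h4 := mul_le_mul_of_nonneg_left h3 hD0
      have h5 := hH m'.state i
      have h6 : ∑ s', q m'.state s' * -(c * ((if m'.state = i then 1 else 0) + v s' -
          v m'.state)) = -(c * ((if m'.state = i then 1 else 0) - v m'.state +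
            ∑ s', q m'.state s' * v s')) := by
        have h7 := Matrix.sum_row_of_mem_rowStochastic hq m'.state
        rw [← one_mul ((if m'.state = i then (1 : ℝ) else 0) -
          v m'.state), ← h7, Finset.sum_mul, ← Finset.sum_add_distrib, Finset.mul_sum,
          ← Finset.sum_neg_distrib]
        refine Finset.sum_congr rfl fun s' _ => by ring
      simp only [hinc]
      rw [h6]
      exact neg_le_neg (mul_le_mul_of_nonneg_left (by linarith) hc0.le)
  -- The summand `H` absorbs `v ≤ H`; it costs `cH ≤ 1` in the exponent, which is the `1` in the
  -- conclusion.
  have h1 := toOuterMeasure_le_of_expect_exp_le (u := -(c * (η * n / 8 + H)))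
    (expect_runEpisode_exp_le (F := fun m' => φ m'.state m'.count) hstep n)
  refine (PMF.toOuterMeasure_mono _ ?_).trans (h1.trans (ENNReal.ofReal_le_ofReal ?_))
  · rintro m' ⟨hm', -⟩
    exact neg_le_neg (mul_le_mul_of_nonneg_left (add_le_add hm' (hvH _)) hc0.le)
  · refine Real.exp_le_exp.2 ?_
    have h2 : φ m.state m.count ≤ 0 := neg_nonpos.2
      (mul_nonneg hc0.le (add_nonneg (rowCount_nonneg _ _) (hv0 _)))
    rw [hcc]
    nlinarith

omit [DecidableEq S] in
/-- The error of the smoothed empirical frequencies. -/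
lemma abs_smoothed_sub_le {N : S → S → ℕ} {i j : S} {p b c : ℝ} (hp0 : 0 ≤ p) (hp1 : p ≤ 1)
    (hc : 0 < c) (hN : c ≤ rowCount N i) (hb : |N i j - rowCount N i * p| ≤ b) :
    |smoothed N i j - p| ≤ (b + 1) / c := by
  have h0 := rowCount_nonneg N i
  have hS0 : 0 ≤ 1 / (Fintype.card S : ℝ) := by positivity
  have hS1 : 1 / (Fintype.card S : ℝ) ≤ 1 := by
    rw [div_le_one (Nat.cast_pos.2 Fintype.card_pos)]
    exact_mod_cast Fintype.card_pos (α := S)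
  have h1 : smoothed N i j - p =
      ((N i j - rowCount N i * p) + (1 / (Fintype.card S : ℝ) - p)) / (rowCount N i + 1) := by
    change ((N i j : ℝ) + 1 / (Fintype.card S : ℝ)) / (rowCount N i + 1) - p = _
    field_simp
    ring
  rw [h1, abs_div, abs_of_pos (by linarith : 0 < rowCount N i + 1)]
  have h2 : |1 / (Fintype.card S : ℝ) - p| ≤ 1 := abs_le.2 ⟨by linarith, by linarith⟩
  exact div_le_div₀ (by linarith [abs_nonneg (N i j - rowCount N i * p)])
    ((abs_add_le _ _).trans (add_le_add hb h2)) hc (by linarith)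

/-- The estimation error after `n` timesteps of an episode. -/
lemma toOuterMeasure_error_le {k : ℕ} {m : Memory S A} (hm : m.count = 0)
    {M : Matrix S S ℝ} (hM : M ∈ Matrix.rowStochastic ℝ S) {D : ℝ}
    (hD : DriftLE g proj cf sc k m M D) {H : ℕ} {η : ℝ} (hη : 0 < η) (hη1 : η ≤ 1)
    (hH : ∀ s s', η ≤ (M ^ H) s s') (hDH : Fintype.card S * D * H ≤ η / 2) {n : ℕ} {L : ℝ}
    (hL : 0 ≤ L) (hLn : L ≤ n) (hn : 1 ≤ n)
    (hLn' : 1 + L ≤ η / (4 * (1 + (H : ℝ)) ^ 2) * η * n / 8) :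
    (runEpisode g proj cf sc k m n).toOuterMeasure
        {m' | Fintype.card S * ((n * D + 2 * √(n * L) + 1) / (η * n / 8)) <
          ‖toMat m'.Phat - M‖} ≤
      ENNReal.ofReal (3 * (Fintype.card S : ℝ) ^ 2 * Real.exp (-L)) := by
  set p := runEpisode g proj cf sc k m n with hp
  have hn0 : (0 : ℝ) < n := Nat.cast_pos.2 hn
  have hD0 : 0 ≤ D := by
    obtain ⟨m', hm'⟩ := p.support_nonempty
    exact (abs_nonneg _).trans (hD n m' hm' (Classical.arbitrary S) (Classical.arbitrary S))
  set b : ℝ := n * D + 2 * √(n * L) with hb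
  set bad : ℝ → S × S → Set (Memory S A) := fun σ x =>
    {m' | b ≤ σ * (m'.count x.1 x.2 - rowCount m'.count x.1 * M x.1 x.2)} with hbad
  set rare : S × S → Set (Memory S A) := fun x => {m' | rowCount m'.count x.1 ≤ η * n / 8}
    with hrare
  -- Restricted to the support, where `Phat` is the smoothed empirical matrix.
  have hsub : {m' : Memory S A | Fintype.card S * ((b + 1) / (η * n / 8)) <
      ‖toMat m'.Phat - M‖} ∩ p.support ⊆
      ⋃ x ∈ (Finset.univ : Finset (S × S)), (bad 1 x ∪ bad (-1) x ∪ rare x) := by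
    rintro m' ⟨hm', hsupp⟩
    by_contra hno
    simp only [hbad, hrare, Finset.mem_univ, Set.iUnion_true, Set.mem_iUnion, Set.mem_union,
      Set.mem_ofPred_eq, not_exists, not_or, not_le, Prod.forall] at hno
    refine absurd hm' (not_lt.2 (frobenius_norm_le _ (by positivity) fun i j => ?_))
    obtain ⟨⟨h1, h2⟩, h3⟩ := hno i j
    rw [Phat_eq_of_mem_support_runEpisode hn hsupp]
    exact abs_smoothed_sub_le (Matrix.nonneg_of_mem_rowStochastic hM)
      (Matrix.le_one_of_mem_rowStochastic hM) (by positivity) h3.le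
      (abs_le.2 ⟨by linarith, by linarith⟩)
  have hone : ∀ x, p.toOuterMeasure (bad 1 x ∪ bad (-1) x ∪ rare x) ≤
      ENNReal.ofReal (3 * Real.exp (-L)) := fun x => by
    have h1 := toOuterMeasure_deviation_le hm hM hD hL hLn hn (σ := 1) (by simp) x.1 x.2
    have h2 := toOuterMeasure_deviation_le hm hM hD hL hLn hn (σ := -1) (by simp) x.1 x.2
    have h3 := (toOuterMeasure_rowCount_le hM hD hη hη1 hH hDH n x.1).trans
      (ENNReal.ofReal_le_ofReal (Real.exp_le_exp.2 (by linarith :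
        1 - η / (4 * (1 + (H : ℝ)) ^ 2) * η * n / 8 ≤ -L)))
    refine (MeasureTheory.measure_union_le _ _).trans ((add_le_add
      ((MeasureTheory.measure_union_le _ _).trans (add_le_add h1 h2)) h3).trans_eq ?_)
    have h0 := (Real.exp_pos (-L)).le
    rw [← ENNReal.ofReal_add h0 h0, ← ENNReal.ofReal_add (add_nonneg h0 h0) h0]
    congr 1
    ring
  refine (p.toOuterMeasure_mono hsub).trans
    ((MeasureTheory.measure_biUnion_finset_le _ _).trans
      ((Finset.sum_le_sum fun x _ => hone x).trans_eq ?_))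
  rw [Finset.sum_const, nsmul_eq_mul, ← ENNReal.ofReal_natCast,
    ← ENNReal.ofReal_mul (Nat.cast_nonneg _)]
  congr 1
  simp only [Finset.card_univ, Fintype.card_prod, Nat.cast_mul]
  ring

end Concentration

/-! ### The estimation error of an episode -/

section Main

variable {S A : Type*} [Fintype S] [DecidableEq S] [Nonempty S]
  [Fintype A] [DecidableEq A] [Nonempty A]
  {g : Game S A} {proj : Simplex S → Simplex S} {cf : Coeffs} {sc : Schedule}

omit [Nonempty S] [DecidableEq A] [Nonempty A] in
lemma norm_toMat_sub_transMat_le (P : S → Simplex S) (pol : S → Simplex A) (mf : Simplex S) :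
    ‖toMat P - transMat g pol mf‖ ≤ Fintype.card S := by
  rw [← mul_one (Fintype.card S : ℝ)]
  refine frobenius_norm_le _ zero_le_one fun i j => abs_le.2 ?_
  have hM := transMat_mem_rowStochastic g pol mf
  have h1 := Matrix.nonneg_of_mem_rowStochastic hM (i := i) (j := j)
  have h2 := Matrix.le_one_of_mem_rowStochastic hM (i := i) (j := j)
  have h3 := stdSimplex.zero_le (P i) j
  have h4 := stdSimplex.le_one (P i) j
  simp only [Matrix.sub_apply, toMat, Matrix.of_apply]
  constructor <;> linarith

/-- The transition probabilities of an episode stay close to the first ones. -/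
lemma LipschitzTrans.driftLE {Lpol Lmf : ℝ} (h : LipschitzTrans g Lpol Lmf) (hζ : 2 ≤ sc.ζ)
    (k : ℕ) (m : Memory S A) :
    DriftLE g proj cf sc k m (transMat g (newPol cf sc k 1 m) (newMf proj cf sc k 1 m))
      ((|Lpol| + |Lmf|) * (4 * (2 : ℝ) ^ (1 - sc.ζ))) := fun _ _ hm' =>
  h.abs_transMat_sub_le (l1Dist_le_of_mem_support_runEpisode hζ hm').2
    (l1Dist_le_of_mem_support_runEpisode hζ hm').1

/-- It suffices to bound the probability of a large error for every memory with which the episode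
may begin. -/
lemma le_errorLaw_toMeasure_Iic {ini : Init S A} {T k : ℕ} {δ B : ℝ} (hδ : 0 < δ)
    (h : ∀ m ∈ (afterEpisodes g proj cf sc ini T (k - 1)).support,
      (runEpisode g proj cf sc k m (T - 1)).toOuterMeasure
        {m' | B < ‖toMat m'.Phat -
          transMat g (newPol cf sc k 1 m) (newMf proj cf sc k 1 m)‖} ≤ ENNReal.ofReal δ) :
    ENNReal.ofReal (1 - δ) ≤ (errorLaw g proj cf sc ini T k).toMeasure (Set.Iic B) := by
  refine le_toMeasure_bind measurableSet_Iic fun m hm => ?_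
  rw [PMF.toMeasure_apply_eq_toOuterMeasure, PMF.toOuterMeasure_map_apply,
    ENNReal.ofReal_sub _ hδ.le, ENNReal.ofReal_one, tsub_le_iff_right,
    ← toOuterMeasure_add_compl (runEpisode g proj cf sc k m (T - 1))]
  refine add_le_add le_rfl ((PMF.toOuterMeasure_mono _ ?_).trans (h m hm))
  rintro m' ⟨hm', -⟩
  rw [Set.mem_ofPred_eq]
  exact lt_of_not_ge fun h => hm' (Set.mem_Iic.2 h)

end Main

/-- The dominant terms of the error bound in the main regime. -/
lemma error_terms_le {s η D L C₁ l : ℝ} {n T : ℕ} (hs : 0 ≤ s) (hη : 0 < η)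
    (hL : L ≤ C₁ * l) (hC₁ : 1 ≤ C₁) (hl : 1 ≤ l) (hn : 1 ≤ n) (hT : T = n + 1) :
    s * ((n * D + 2 * √(n * L) + 1) / (η * n / 8)) ≤
      8 * s / η * D + 32 * s * C₁ / η * (l * (T : ℝ) ^ (-(1 / 2) : ℝ)) +
        16 * s / η * (l * (T : ℝ) ^ (-1 : ℝ)) := by
  have hn0 : (0 : ℝ) < n := Nat.cast_pos.2 hn
  have hn1 : (1 : ℝ) ≤ n := Nat.one_le_cast.2 hn
  have hT1 : (T : ℝ) = n + 1 := by rw [hT]; push_cast; rfl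
  have hT0 : (0 : ℝ) < T := by linarith
  have h1 : (T : ℝ) ^ (-(1 / 2) : ℝ) = 1 / √T := by
    rw [Real.rpow_neg hT0.le, ← Real.sqrt_eq_rpow, one_div]
  have h2 : (T : ℝ) ^ (-1 : ℝ) = 1 / T := by rw [Real.rpow_neg_one, one_div]
  have h3 : √(n * L) / n ≤ 2 * C₁ * (l * (1 / √T)) := by
    have hC : 1 ≤ C₁ * l := one_le_mul_of_one_le_of_one_le hC₁ hl
    -- Bounding `√L` by `C₁ * l ≥ 1` gives away a square root of the logarithm, so that the power `p
    -- = 1` suffices.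
    have h4 : √(n * L) ≤ √n * (C₁ * l) := by
      rw [← Real.sqrt_sq (by linarith : 0 ≤ C₁ * l), ← Real.sqrt_mul hn0.le]
      exact Real.sqrt_le_sqrt (by gcongr; nlinarith)
    have h5 : √T ≤ 2 * √n := by
      rw [show (2 : ℝ) = √(2 ^ 2) by simp, ← Real.sqrt_mul (by norm_num)]
      exact Real.sqrt_le_sqrt (by linarith)
    have h6 : 0 < √T := Real.sqrt_pos.2 hT0
    have h7 : √(n : ℝ) * √n = n := Real.mul_self_sqrt hn0.le
    have h8 : 0 < √(n : ℝ) := Real.sqrt_pos.2 hn0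
    rw [div_le_iff₀ hn0]
    have h9 : 2 * C₁ * (l * (1 / √T)) * n = (C₁ * l) * √n * (2 * √n / √T) := by
      calc _ = 2 * C₁ * (l * (1 / √T)) * (√(n : ℝ) * √n) := by rw [h7]
        _ = _ := by ring
    rw [h9]
    refine h4.trans ?_
    rw [mul_comm (√(n : ℝ))]
    exact (le_mul_of_one_le_right (by positivity) ((one_le_div h6).2 h5))
  have h4 : 1 / (n : ℝ) ≤ 2 * (l * (1 / T)) := by
    rw [← mul_assoc, mul_one_div, div_le_div_iff₀ hn0 hT0]
    nlinarith
  have h5 : s * ((n * D + 2 * √(n * L) + 1) / (η * n / 8)) =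
      8 * s / η * D + 16 * s / η * (√(n * L) / n) + 8 * s / η * (1 / n) := by
    field_simp
    ring
  rw [h5, h1, h2]
  have h6 : 0 ≤ s / η := by positivity
  have h7 := mul_le_mul_of_nonneg_left h3 h6
  have h8 := mul_le_mul_of_nonneg_left h4 h6
  have h9 : 16 * s / η * (√(n * L) / n) = 16 * (s / η * (√(n * L) / n)) := by ring
  have h10 : 8 * s / η * (1 / n) = 8 * (s / η * (1 / n)) := by ring
  rw [h9, h10]
  linear_combination 16 * h7 + 8 * h8

end

end Sandbox

/-- For a communicating game with Lipschitz transition matrices, there are constants `C`, `p` that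
do not depend on the exponents of the learning rates (in particular on `ζ`), on the initialization,
on the episode length `T`, on the episode `k` or on the confidence `δ`, such that with probability
at least `1 - δ` the error `‖P̂^k_T - P_{π^k_1, μ^k_1}‖_F` is at most
`C (ℓ^p T^{-1/2} + ℓ^p T^{-1} + 2^{1-ζ})` with `ℓ = 1 + log T + log (1/δ)`. -/
theorem mainTheorem4 {S A : Type*} [Fintype S] [DecidableEq S] [Nonempty S]
    [Fintype A] [DecidableEq A] [Nonempty A]
    (g : Sandbox.Game S A) (net : Finset (Simplex S)) (εnet : ℝ)
    (hnet : Sandbox.IsNet net εnet)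
    (proj : Simplex S → Simplex S) (hproj : Sandbox.IsProjection net proj)
    (hcomm : Sandbox.Communicating g net)
    (Lpol Lmf : ℝ) (hLip : Sandbox.LipschitzTrans g Lpol Lmf)
    (cf : Sandbox.Coeffs) :
    ∃ (C : ℝ) (p : ℕ), ∀ (sc : Sandbox.Schedule) (ini : Sandbox.Init S A) (T k : ℕ) (δ : ℝ),
      1 ≤ T → 1 ≤ k → 0 < δ → δ < 1 →
      ENNReal.ofReal (1 - δ) ≤
        (Sandbox.errorLaw g proj cf sc ini T k).toMeasure
          (Set.Iic (C * ((1 + Real.log T + Real.log (1 / δ)) ^ p * (T : ℝ) ^ (-(1 / 2) : ℝ)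
            + (1 + Real.log T + Real.log (1 / δ)) ^ p * (T : ℝ) ^ (-1 : ℝ)
            + (2 : ℝ) ^ (1 - sc.ζ)))) := by
  open Sandbox in
  obtain ⟨H, η, hη, hη1, hH⟩ := hcomm.exists_pow_ge (exploration_pos (A := A) (cf := cf))
  set s : ℝ := (Fintype.card S : ℝ) with hs
  have hs1 : 1 ≤ s := Nat.one_le_cast.2 Fintype.card_pos
  set Λ : ℝ := |Lpol| + |Lmf| with hΛ
  have hΛ0 : 0 ≤ Λ := by positivity
  set c : ℝ := η / (4 * (1 + (H : ℝ)) ^ 2) * η / 8 with hc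
  have hc0 : 0 < c := by positivity
  have hlog : 0 ≤ Real.log (3 * s ^ 2) := Real.log_nonneg (by nlinarith)
  set C₁ : ℝ := 1 + Real.log (3 * s ^ 2) with hC₁
  have hC₁1 : 1 ≤ C₁ := by linarith
  -- With `L ≤ C₁ * l`, the condition `n ≥ C₂ * l` ensures both `L ≤ n` and `1 + L ≤ c * n`.
  set C₂ : ℝ := C₁ + (1 + C₁) / c with hC₂
  have hC₂1 : C₁ ≤ C₂ := le_add_of_nonneg_right (by positivity)
  have hC₂c : 1 + C₁ ≤ c * C₂ := by
    rw [hC₂, mul_add, mul_div_cancel₀ _ hc0.ne']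
    exact le_add_of_nonneg_left (by positivity)
  -- The first three summands make the bound at least `s` when `ζ < 2`, when the drift is too large
  -- for the Doeblin argument, and when the episode is short; the last three come from
  -- `error_terms_le`.
  refine ⟨2 * s + 8 * s ^ 2 * Λ * H / η + 2 * C₂ * s + 32 * s * Λ / η + 32 * s * C₁ / η +
    16 * s / η, 1, fun sc ini T k δ hT hk hδ hδ1 => ?_⟩
  set x : ℝ := (2 : ℝ) ^ (1 - sc.ζ) with hx
  have hx0 : 0 < x := by positivity
  have hlT : 0 ≤ Real.log T := Real.log_nonneg (Nat.one_le_cast.2 hT)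
  have hlδ : 0 ≤ Real.log (1 / δ) := Real.log_nonneg ((one_le_div hδ).2 hδ1.le)
  set l : ℝ := 1 + Real.log T + Real.log (1 / δ) with hl
  have hl1 : 1 ≤ l := by linarith
  have hT0 : (0 : ℝ) < T := Nat.cast_pos.2 hT
  rw [pow_one]
  set y : ℝ := l * (T : ℝ) ^ (-(1 / 2) : ℝ) with hy
  have hy0 : 0 ≤ y := by positivity
  set z : ℝ := l * (T : ℝ) ^ (-1 : ℝ) with hz
  have hz0 : 0 ≤ z := by positivity
  set B : ℝ := (2 * s + 8 * s ^ 2 * Λ * H / η + 2 * C₂ * s + 32 * s * Λ / η + 32 * s * C₁ / η +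
    16 * s / η) * (y + z + x) with hB
  have hBle : ∀ a₁ a₂ a₃ a₄ a₅ a₆ : ℝ, 0 ≤ a₁ → 0 ≤ a₂ → 0 ≤ a₃ → 0 ≤ a₄ → 0 ≤ a₅ → 0 ≤ a₆ →
      a₁ * x + a₂ * x + a₃ * z + a₄ * x + a₅ * y + a₆ * z ≤
        (a₁ + a₂ + a₃ + a₄ + a₅ + a₆) * (y + z + x) := by
    intro a₁ a₂ a₃ a₄ a₅ a₆ h₁ h₂ h₃ h₄ h₅ h₆
    have e : (a₁ + a₂ + a₃ + a₄ + a₅ + a₆) * (y + z + x) =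
        a₁ * x + a₂ * x + a₃ * z + a₄ * x + a₅ * y + a₆ * z + ((a₁ + a₂ + a₄) * (y + z) +
          (a₃ + a₆) * (y + x) + a₅ * (z + x)) := by ring
    rw [e]
    exact le_add_of_nonneg_right (by positivity)
  have hB' := hBle (2 * s) (8 * s ^ 2 * Λ * H / η) (2 * C₂ * s) (32 * s * Λ / η)
    (32 * s * C₁ / η) (16 * s / η) (by positivity) (by positivity) (by positivity)
    (by positivity) (by positivity) (by positivity)
  rw [← hB] at hB'
  have g₁ : 0 ≤ 2 * s * x := by positivity
  have g₂ : 0 ≤ 8 * s ^ 2 * Λ * H / η * x := by positivity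
  have g₃ : 0 ≤ 2 * C₂ * s * z := by positivity
  have g₄ : 0 ≤ 32 * s * Λ / η * x := by positivity
  have g₅ : 0 ≤ 32 * s * C₁ / η * y := by positivity
  have g₆ : 0 ≤ 16 * s / η * z := by positivity
  refine le_errorLaw_toMeasure_Iic hδ fun m hm => ?_
  obtain ⟨hcount, hexp⟩ := of_mem_support_afterEpisodes hT hm
  have htriv : s ≤ B → (runEpisode g proj cf sc k m (T - 1)).toOuterMeasure
      {m' | B < ‖toMat m'.Phat -
        transMat g (newPol cf sc k 1 m) (newMf proj cf sc k 1 m)‖} ≤ ENNReal.ofReal δ := fun h => by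
    have he : {m' : Memory S A | B < ‖toMat m'.Phat -
        transMat g (newPol cf sc k 1 m) (newMf proj cf sc k 1 m)‖} = ∅ :=
      Set.eq_empty_of_forall_notMem fun m' hm' =>
        absurd ((norm_toMat_sub_transMat_le _ _ _).trans h) (not_le.2 hm')
    rw [he, MeasureTheory.measure_empty]
    exact zero_le
  rcases lt_or_ge sc.ζ 2 with hζ | hζ
  · refine htriv ?_
    have h1 : (2 : ℝ) ^ (-1 : ℝ) ≤ x :=
      Real.rpow_le_rpow_of_exponent_le one_le_two (by linarith)
    rw [Real.rpow_neg_one] at h1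
    have h2 := mul_le_mul_of_nonneg_left h1 (by linarith : 0 ≤ s)
    linarith
  rcases lt_or_ge (η / 2) (s * (Λ * (4 * x)) * H) with hD | hD
  · refine htriv ?_
    have h1 : s ≤ 8 * s ^ 2 * Λ * H / η * x := by
      have e : 8 * s ^ 2 * Λ * H / η * x = s * ((s * (Λ * (4 * x)) * H) * 2 / η) := by
        field_simp
        ring
      rw [e]
      refine le_mul_of_one_le_right (by linarith) ((one_le_div hη).2 (by linarith))
    linarith
  obtain ⟨n, rfl⟩ : ∃ n, T = n + 1 := ⟨T - 1, by omega⟩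
  rcases lt_or_ge (n : ℝ) (C₂ * l) with hn | hn
  · refine htriv ?_
    have h1 : 1 ≤ 2 * C₂ * z := by
      rw [hz, Real.rpow_neg_one, ← div_eq_mul_inv, ← mul_div_assoc, one_le_div hT0]
      have h2 := one_le_mul_of_one_le_of_one_le (hC₁1.trans hC₂1) hl1
      push_cast
      linarith
    have h2 := mul_le_mul_of_nonneg_left h1 (by linarith : 0 ≤ s)
    linarith
  rw [Nat.add_sub_cancel]
  -- Solves `3 * s ^ 2 * exp (-L) = δ`: three bad events for each of the `s ^ 2` pairs of states.
  set L : ℝ := Real.log (3 * s ^ 2) + Real.log (1 / δ) with hL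
  have hL0 : 0 ≤ L := by positivity
  have hLl : L ≤ C₁ * l := by
    have h1 := mul_nonneg hlog (sub_nonneg.2 hl1)
    rw [hL, hC₁, show Real.log (1 / δ) = l - 1 - Real.log (n + 1 : ℕ) by rw [hl]; ring]
    linear_combination h1 + hlT
  have hn1 : 1 ≤ n := by
    have h1 : (1 : ℝ) ≤ n :=
      (one_le_mul_of_one_le_of_one_le (hC₁1.trans hC₂1) hl1).trans hn
    exact_mod_cast h1
  have hLn : L ≤ n := hLl.trans (le_trans (by gcongr) hn)
  have hLn' : 1 + L ≤ η / (4 * (1 + (H : ℝ)) ^ 2) * η * n / 8 := by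
    have h1 : c * (C₂ * l) ≤ c * n := by gcongr
    have h2 : c * n = η / (4 * (1 + (H : ℝ)) ^ 2) * η * n / 8 := by rw [hc]; ring
    have h3 := mul_le_mul_of_nonneg_right hC₂c (by linarith : 0 ≤ l)
    rw [← h2]
    linarith
  have hexp' := exploration_le_newPol (sc := sc) (k := k) (t := 1)
    (hexp.imp_right fun h => ⟨by omega, rfl⟩)
  have hmem : newMf proj cf sc k 1 m ∈ net := by
    simp only [newMf, if_true]
    exact (hproj _).1
  have hmain := toOuterMeasure_error_le hcount (transMat_mem_rowStochastic g _ _)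
    (hLip.driftLE hζ k m) hη hη1 (hH _ hmem _ hexp') hD hL0 hLn hn1 hLn'
  have hδL : 3 * s ^ 2 * Real.exp (-L) = δ := by
    rw [hL, one_div, Real.log_inv, neg_add, neg_neg, Real.exp_add, Real.exp_neg,
      Real.exp_log (by positivity), Real.exp_log hδ, mul_inv_cancel_left₀ (by positivity)]
  rw [← hs, hδL] at hmain
  refine (PMF.toOuterMeasure_mono _ ?_).trans hmain
  rintro m' ⟨hm', -⟩
  rw [Set.mem_ofPred_eq] at hm' ⊢
  refine lt_of_le_of_lt ?_ hm'
  have h1 := error_terms_le (D := Λ * (4 * x)) (s := s) (by linarith) hη hLl hC₁1 hl1 hn1 rfl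
  refine h1.trans (le_trans (le_of_eq ?_) (by linarith : 32 * s * Λ / η * x +
    32 * s * C₁ / η * y + 16 * s / η * z ≤ B))
  rw [hy, hz]
  ring
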